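/- **Setting.** Norms on $\mathbb R^n,\mathbb R^m$ are infinity norms. Let $(\Omega,\mathcal F,\mathbb P)$ be a probability space with a filtration $(\mathcal F_t)_{t\ge 0}$ satisfying the usual conditions, and let $W$ be a $p$-dimensional Brownian motion relative to it. Let $\tau,\eta,\mu>0$, $q\ge 1$, and let $\Sigma=(\mathbb R^n,\mathsf U,\mathcal U_\tau,f,\sigma)$ be a stochastic control system $d\xi=f(\xi,\upsilon)\,dt+\sigma(\xi)\,dW_t$, where $\mathsf U\subseteq\mathbb R^m$, $\mathcal U_\tau$ is the set of curves $\upsilon:[0,\infty)\to\mathsf U$ that are constant on every interval $[k\tau,(k+1)\tau)$, $k\in\mathbb N_0$, and $f:\mathbb R^n\times\mathsf U\to\mathbb R^n$, $\sigma:\mathbb R^n\to\mathbb R^{n\times p}$ are Lipschitz continuous. A *system* is a tuple $(X,X_0,U,\longrightarrow,Y,H)$ of states, initial states $X_0\subseteq X$, inputs, transitions $\longrightarrow\ \subseteq X\times U\times X$, outputs, and an output map $H:X\to Y$. Below, $Y$ is the set of all $\mathbb R^n$-valued random variables on $\Omega$, with the $q$-th moment metric $\mathbf d(y,y')=(\mathbb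 E\|y-y'\|^q)^{1/q}\in[0,\infty]$. * $S_\tau(\Sigma)$ has $X_\tau=Y$; initial states the almost surely constant random variables; inputs $\mathcal U_\tau$; $H_\tau=\mathrm{id}$; and $x\xrightarrow{\ \upsilon\ }x'$ iff for some $k\in\mathbb N_0$ the variables $x,x'$ are $\mathcal F_{k\tau}$- and $\mathcal F_{(k+1)\tau}$-measurable respectively, and the solution process started from $x$ at time $k\tau$ and driven by $\upsilon$ (with $\upsilon$ evaluated at the time elapsed since $k\tau$) equals $x'$ almost surely after time $\tau$. * $S_{\mathsf q}(\Sigma)$, $\mathsf q=(\tau,\eta,\mu)$, has as states, all of them initial, the points of $\eta\mathbb Z^n$; as inputs the points of $\mathsf U\cap\mu\mathbb Z^m$; $H_{\mathsf q}(x)$ is the constant random variable $x$; and $x\xrightarrow{\ u\ }x'$ iff $\|\bar\xi(\tau)-x'\|\le\eta$, where $\bar\xi'=f(\bar\xi,u)$ on $[0,\tau]$ and $\bar\xi(0)=x$. A relation $R\subseteq X_a\times X_b$ is an *$\varepsilon$-approximate simulation relation* from $S_a$ to $S_b$ if (i) every $x_a\in X_{a0}$ is related to some $x_b\in X_{b0}$;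 (ii) $\mathbf d(H_a(x_a),H_b(x_b))\le\varepsilon$ for all $(x_a,x_b)\in R$; (iii) whenever $(x_a,x_b)\in R$ and $x_a\xrightarrow{\ u_a\ }x_a'$, there is a transition $x_b\xrightarrow{\ u_b\ }x_b'$ with $(x_a',x_b')\in R$. It is an *$(\epsilon_{\mathrm{prob}},\hat\varepsilon)$-approximate simulation relation* if instead of (ii) it satisfies (ii$'$) $\mathbb P\{\|H_a(x_a)-H_b(x_b)\|\ge\epsilon_{\mathrm{prob}}\}\le\hat\varepsilon$ for all $(x_a,x_b)\in R$. In either sense, $S_a$ and $S_b$ are *approximately bisimilar* if there is a relation $R$ such that $R$ is an approximate simulation relation from $S_a$ to $S_b$ and $R^{-1}$ is one from $S_b$ to $S_a$. **Theorem.** Let $\epsilon_{\mathrm{prob}}>0$, $\hat\varepsilon\in[0,1]$ and $\varepsilon=\epsilon_{\mathrm{prob}}\,\hat\varepsilon$. If $S_\tau(\Sigma)$ and $S_{\mathsf q}(\Sigma)$ are $\varepsilon$-approximately bisimilar, then they are $(\epsilon_{\mathrm{prob}},\hat\varepsilon)$-approximately bisimilar. -/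

import Mathlib

open MeasureTheory ProbabilityTheory Filter Topology
open scoped NNReal ENNReal

namespace StochSymb

/-! ### Probabilistic set-up -/

section Basis

variable {Ω : Type*} [mΩ : MeasurableSpace Ω]

/-- The usual conditions: `ℱ` is right-continuous and `ℱ 0` contains all null events. -/
structure UsualConditions (ℱ : Filtration ℝ≥0 mΩ) (P : Measure Ω) : Prop where
  rightCont : ℱ.IsRightContinuous
  complete : ∀ A : Set Ω, MeasurableSet A → P A = 0 → MeasurableSet[ℱ 0] A

/-- `W` is a `p`-dimensional standard Brownian motion relative to the filtration `ℱ`. -/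
structure IsBrownianMotion {p : ℕ} (ℱ : Filtration ℝ≥0 mΩ) (P : Measure Ω)
    (W : ℝ≥0 → Ω → (Fin p → ℝ)) : Prop where
  adapted : ∀ t, Measurable[ℱ t] (W t)
  zero : ∀ᵐ ω ∂P, W 0 ω = 0
  cont : ∀ᵐ ω ∂P, Continuous fun t => W t ω
  law : ∀ s t, s ≤ t →
    P.map (fun ω => W t ω - W s ω) = Measure.pi fun _ : Fin p => gaussianReal 0 (t - s)
  indep : ∀ s t, s ≤ t →
    Indep (ℱ s) (MeasurableSpace.comap (fun ω => W t ω - W s ω) inferInstance) P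

/-- The filtration `t ↦ ℱ (t₀ + t)`. -/
def shiftFiltration (ℱ : Filtration ℝ≥0 mΩ) (t₀ : ℝ≥0) : Filtration ℝ≥0 mΩ where
  seq t := ℱ (t₀ + t)
  mono' _ _ h := ℱ.mono (by gcongr)
  le' t := ℱ.le (t₀ + t)

/-- An elementary matrix-valued process `∑_{j < N} e_j 1_{[t_j, t_{j+1})}` with each `e_j` bounded
and `ℱ (t_j)`-measurable. -/
structure ElemProcess (n p : ℕ) (ℱ : Filtration ℝ≥0 mΩ) where
  N : ℕ
  time : ℕ → ℝ≥0
  mono : Monotone time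
  e : ℕ → Ω → Matrix (Fin n) (Fin p) ℝ
  meas : ∀ j a b, Measurable[ℱ (time j)] fun ω => e j ω a b
  bdd : ∃ C : ℝ, ∀ j ω a b, |e j ω a b| ≤ C

/-- The value of an elementary process at time `s`. -/
noncomputable def ElemProcess.value {n p : ℕ} {ℱ : Filtration ℝ≥0 mΩ} (φ : ElemProcess n p ℱ)
    (s : ℝ≥0) (ω : Ω) : Matrix (Fin n) (Fin p) ℝ :=
  ∑ j ∈ Finset.range φ.N, (Set.Ico (φ.time j) (φ.time (j + 1))).indicator (fun _ => φ.e j ω) s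

/-- The integral `∫_0^T φ dW = ∑_j e_j (W_{t_{j+1} ∧ T} - W_{t_j ∧ T})` of an elementary
process. -/
noncomputable def ElemProcess.integral {n p : ℕ} {ℱ : Filtration ℝ≥0 mΩ} (φ : ElemProcess n p ℱ)
    (W : ℝ≥0 → Ω → (Fin p → ℝ)) (T : ℝ≥0) (ω : Ω) : Fin n → ℝ :=
  ∑ j ∈ Finset.range φ.N,
    (φ.e j ω).mulVec (W (min (φ.time (j + 1)) T) ω - W (min (φ.time j) T) ω)

/-- `M t` is (a version of) the Itô integral `∫_0^t H_s dW_s` for every `t`: there are elementary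
processes `φ k` with `∫_0^T |H - φ k|² ds → 0` and `∫_0^T φ k dW → M T` in probability,
for every `T`. -/
def IsItoIntegral {n p : ℕ} (ℱ : Filtration ℝ≥0 mΩ) (P : Measure Ω)
    (W : ℝ≥0 → Ω → (Fin p → ℝ)) (H : ℝ≥0 → Ω → Matrix (Fin n) (Fin p) ℝ)
    (M : ℝ≥0 → Ω → (Fin n → ℝ)) : Prop :=
  ∃ φ : ℕ → ElemProcess n p ℱ, ∀ T : ℝ≥0,
    (∀ δ : ℝ≥0∞, 0 < δ → Tendsto (fun k => P {ω | δ ≤ ∫⁻ s in Set.Icc (0 : ℝ) T,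
      ENNReal.ofReal (∑ a, ∑ b, (H s.toNNReal ω a b - (φ k).value s.toNNReal ω a b) ^ 2)}) atTop (𝓝 0)) ∧
    TendstoInMeasure P (fun k => (φ k).integral W T) atTop (M T)

/-- The `ℝⁿ`-valued random variables on `Ω`. -/
abbrev RandVar (Ω : Type*) [MeasurableSpace Ω] (n : ℕ) : Type _ :=
  {y : Ω → (Fin n → ℝ) // Measurable y}

/-- The `q`-th moment metric `d(y, y') = (𝔼 ‖y - y'‖^q)^(1/q)`, with `‖·‖` the infinity norm; it is
`∞` when the moment is infinite. -/
noncomputable def momentDist (P : Measure Ω) {n : ℕ} (q : ℝ) (y y' : RandVar Ω n) : ℝ≥0∞ :=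
  (∫⁻ ω, ENNReal.ofReal ‖y.1 ω - y'.1 ω‖ ^ q ∂P) ^ (1 / q)

end Basis

/-! ### Systems and approximate bisimulations -/

universe u v w v' w'

/-- A system `(X, X₀, U, ⟶, Y, H)` with output set `Y`. -/
structure System (Y : Type u) where
  State : Type v
  init : Set State
  Input : Type w
  trans : State → Input → State → Prop
  out : State → Y

/-- `R` is an `ε`-approximate simulation relation from `A` to `B`, for the metric `d` on the common
output set. -/
def IsApproxSim {Y : Type u} (d : Y → Y → ℝ≥0∞) (ε : ℝ)
    (A : System.{u, v, w} Y) (B : System.{u, v', w'} Y)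
    (R : A.State → B.State → Prop) : Prop :=
  (∀ a ∈ A.init, ∃ b ∈ B.init, R a b) ∧
  (∀ a b, R a b → d (A.out a) (B.out b) ≤ ENNReal.ofReal ε) ∧
  (∀ a b, R a b → ∀ u a', A.trans a u a' → ∃ v b', B.trans b v b' ∧ R a' b')

/-- `A` and `B` are `ε`-approximately bisimilar for the metric `d`. -/
def ApproxBisimilar {Y : Type u} (d : Y → Y → ℝ≥0∞) (ε : ℝ)
    (A : System.{u, v, w} Y) (B : System.{u, v', w'} Y) : Prop :=
  ∃ R : A.State → B.State → Prop,
    IsApproxSim d ε A B R ∧ IsApproxSim d ε B A fun b a => R a b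

/-- `R` is an `(ε, ε')`-approximate simulation relation from `A` to `B`: related states satisfy
`P {‖H_A - H_B‖ ≥ ε} ≤ ε'`. -/
def IsProbApproxSim {Ω : Type u} [MeasurableSpace Ω] {n : ℕ} (P : Measure Ω) (ε ε' : ℝ)
    (A : System.{u, v, w} (RandVar Ω n)) (B : System.{u, v', w'} (RandVar Ω n)) (R : A.State → B.State → Prop) : Prop :=
  (∀ a ∈ A.init, ∃ b ∈ B.init, R a b) ∧
  (∀ a b, R a b → P {ω | ‖(A.out a).1 ω - (B.out b).1 ω‖ ≥ ε} ≤ ENNReal.ofReal ε') ∧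
  (∀ a b, R a b → ∀ u a', A.trans a u a' → ∃ v b', B.trans b v b' ∧ R a' b')

/-- `A` and `B` are `(ε, ε')`-approximately bisimilar. -/
def ProbApproxBisimilar {Ω : Type u} [MeasurableSpace Ω] {n : ℕ} (P : Measure Ω) (ε ε' : ℝ)
    (A : System.{u, v, w} (RandVar Ω n)) (B : System.{u, v', w'} (RandVar Ω n)) : Prop :=
  ∃ R : A.State → B.State → Prop,
    IsProbApproxSim P ε ε' A B R ∧ IsProbApproxSim P ε ε' B A fun b a => R a b

/-! ### Stochastic control systems -/

section ControlSystem

open scoped Matrix.Norms.Operator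

/-- A stochastic control system `(ℝⁿ, U, 𝒰, f, σ)` with `U ⊆ ℝᵐ` and `σ` valued in `ℝ^{n × p}`.
Vectors carry the infinity norm, matrices the induced norm (maximal absolute row sum). -/
structure ControlSystem (n m p : ℕ) where
  U : Set (Fin m → ℝ)
  inputs : Set (ℝ≥0 → U)
  inputs_measurable : ∀ υ ∈ inputs, Measurable υ
  inputs_locBdd : ∀ υ ∈ inputs, ∀ T : ℝ≥0, ∃ C : ℝ,
    ∀ᵐ t ∂(volume.restrict (Set.Ico (0 : ℝ) T)), ‖(υ t.toNNReal : Fin m → ℝ)‖ ≤ C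
  f : (Fin n → ℝ) → U → (Fin n → ℝ)
  f_cont : Continuous fun z : (Fin n → ℝ) × U => f z.1 z.2
  f_lip : ∃ Lx > (0 : ℝ), ∃ Lu > (0 : ℝ), ∀ x x' (u u' : U),
    ‖f x u - f x' u'‖ ≤ Lx * ‖x - x'‖ + Lu * ‖(u : Fin m → ℝ) - u'‖
  σ : (Fin n → ℝ) → Matrix (Fin n) (Fin p) ℝ
  σ_cont : Continuous σ
  σ_lip : ∃ Z > (0 : ℝ), ∀ x x', ‖σ x - σ x'‖ ≤ Z * ‖x - x'‖

end ControlSystem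

/-- The set `𝒰_τ` of `U`-valued curves that are constant on each `[kτ, (k+1)τ)`. -/
def sampledInputs {m : ℕ} (U : Set (Fin m → ℝ)) (τ : ℝ≥0) : Set (ℝ≥0 → U) :=
  {υ | ∀ (k : ℕ) (t : ℝ≥0), k * τ ≤ t → t < (k + 1) * τ → υ t = υ (k * τ)}

/-- The points of `A` all of whose coordinates are integer multiples of `η`. -/
def grid {n : ℕ} (A : Set (Fin n → ℝ)) (η : ℝ) : Set (Fin n → ℝ) :=
  {x | x ∈ A ∧ ∃ k : Fin n → ℤ, ∀ i, x i = k i * η}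

variable {n m p : ℕ}

/-- `ξ` is the solution process started at time `t₀` from the random variable `a`, driven by the
input curve `υ`; the argument of `ξ` and of `υ` is the time elapsed since `t₀`:
`ξ_t = a + ∫_0^t f(ξ_s, υ_s) ds + ∫_0^t σ(ξ_s) dW_{t₀+s}` almost surely, with `ξ` continuous and
adapted to `t ↦ ℱ (t₀ + t)`. For `t₀ = 0` this is a solution process of the control system. -/
def IsSolution (S : ControlSystem n m p) {Ω : Type*} [mΩ : MeasurableSpace Ω]
    (ℱ : Filtration ℝ≥0 mΩ) (P : Measure Ω) (W : ℝ≥0 → Ω → (Fin p → ℝ))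
    (t₀ : ℝ≥0) (a : Ω → (Fin n → ℝ)) (υ : ℝ≥0 → S.U) (ξ : ℝ≥0 → Ω → (Fin n → ℝ)) : Prop :=
  (∀ t, Measurable[ℱ (t₀ + t)] (ξ t)) ∧
  (∀ᵐ ω ∂P, Continuous fun t => ξ t ω) ∧
  ∃ M : ℝ≥0 → Ω → (Fin n → ℝ),
    IsItoIntegral (shiftFiltration ℱ t₀) P (fun t => W (t₀ + t)) (fun s ω => S.σ (ξ s ω)) M ∧
    ∀ᵐ ω ∂P, ∀ t : ℝ≥0, ξ t ω =
      a ω + (∫ s in (0 : ℝ)..t, S.f (ξ s.toNNReal ω) (υ s.toNNReal)) + M t ω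

/-- The sampled system `S_τ`: its states and outputs are the `ℝⁿ`-valued random variables, its
initial states the deterministic ones (those whose law is a Dirac mass), its inputs are the input
curves of the control system, and `x ⟶ x'` under `υ` when, for some `k`, `x` and `x'` are
measurable at the times `kτ` and `(k+1)τ` and the solution started from `x` at time `kτ` under `υ`
equals `x'` after the time `τ`, almost surely. -/
def sampledSystem (S : ControlSystem n m p) {Ω : Type u} [mΩ : MeasurableSpace Ω]
    (ℱ : Filtration ℝ≥0 mΩ) (P : Measure Ω) (W : ℝ≥0 → Ω → (Fin p → ℝ)) (τ : ℝ≥0) :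
    System.{u, u, 0} (RandVar Ω n) where
  State := RandVar Ω n
  init := {x | ∃ c : Fin n → ℝ, ∀ᵐ ω ∂P, x.1 ω = c}
  Input := S.inputs
  trans x υ x' := ∃ k : ℕ,
    Measurable[ℱ (k * τ)] x.1 ∧ Measurable[ℱ ((k + 1) * τ)] x'.1 ∧
    ∃ ξ : ℝ≥0 → Ω → (Fin n → ℝ),
      IsSolution S ℱ P W (k * τ) x.1 υ.1 ξ ∧ ∀ᵐ ω ∂P, ξ τ ω = x'.1 ω
  out x := x

/-- The symbolic system `S_q` for `q = (τ, η, μ)`: its states (all initial) are the points of the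
`η`-grid of `ℝⁿ`, its inputs the points of the `μ`-grid of `U`, and `x ⟶ x'` under `u` when `x'` is
within `η` of the time-`τ` value of the solution of `ξ̄' = f(ξ̄, u)`, `ξ̄(0) = x`; the output of a
state is the constant random variable. -/
def symbolicSystem (S : ControlSystem n m p) (Ω : Type u) [MeasurableSpace Ω]
    (τ : ℝ≥0) (η μ : ℝ) : System.{u, 0, 0} (RandVar Ω n) where
  State := grid (Set.univ : Set (Fin n → ℝ)) η
  init := Set.univ
  Input := {u : S.U // u.1 ∈ grid S.U μ}
  trans x u x' := ∃ ξ : ℝ → (Fin n → ℝ), ξ 0 = x.1 ∧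
    (∀ t ∈ Set.Icc (0 : ℝ) τ, HasDerivWithinAt ξ (S.f (ξ t) u.1) (Set.Icc 0 τ) t) ∧
    ‖ξ τ - x'.1‖ ≤ η
  out x := ⟨fun _ => x.1, measurable_const⟩

end StochSymb

/-!
An approximate bisimulation relation for the `q`-th moment metric, of precision `εprob * εhat`, is
itself an `(εprob, εhat)`-approximate bisimulation relation: the conditions on initial states and
on transitions do not involve the metric, so only the two conditions on outputs are to be compared.
If `d(y, y') ≤ εprob * εhat`, then Markov's inequality bounds `P {‖y - y'‖ ≥ εprob}` by
`𝔼 ‖y - y'‖ / εprob`, and since `P` is a probability measure and `q ≥ 1`, Jensen's inequality bounds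
the first moment by `d(y, y')`; so the probability is at most `εhat`. These are the lemmas
`lintegral_norm_sub_le_momentDist` and `measure_le_of_momentDist_le`.

The comparison concerns outputs only and is made for arbitrary systems whose outputs are random
variables (`ApproxBisimilar.probApproxBisimilar`).
-/

namespace StochSymb

/-- The first moment is at most the `q`-th moment metric, by monotonicity of `Lᵖ` norms on a
probability space. -/
lemma lintegral_norm_sub_le_momentDist {Ω : Type*} [MeasurableSpace Ω] (P : Measure Ω)
    [IsProbabilityMeasure P] {n : ℕ} {q : ℝ} (hq : 1 ≤ q) (y y' : RandVar Ω n) :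
    ∫⁻ ω, ENNReal.ofReal ‖y.1 ω - y'.1 ω‖ ∂P ≤ momentDist P q y y' := by
  have h := eLpNorm'_le_eLpNorm'_of_exponent_le zero_lt_one hq P
    (y.2.sub y'.2).aestronglyMeasurable
  simpa [eLpNorm', momentDist, ofReal_norm] using h

lemma measure_le_of_momentDist_le {Ω : Type*} [MeasurableSpace Ω] (P : Measure Ω)
    [IsProbabilityMeasure P] {n : ℕ} {q : ℝ} (hq : 1 ≤ q) {ε ε' : ℝ} (hε : 0 < ε)
    {y y' : RandVar Ω n} (h : momentDist P q y y' ≤ ENNReal.ofReal (ε * ε')) :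
    P {ω | ‖y.1 ω - y'.1 ω‖ ≥ ε} ≤ ENNReal.ofReal ε' := by
  have hset : {ω | ‖y.1 ω - y'.1 ω‖ ≥ ε} =
      {ω | ENNReal.ofReal ε ≤ ENNReal.ofReal ‖y.1 ω - y'.1 ω‖} := by
    ext ω
    exact (ENNReal.ofReal_le_ofReal_iff (norm_nonneg _)).symm
  have hmeas : Measurable fun ω => ENNReal.ofReal ‖y.1 ω - y'.1 ω‖ :=
    (y.2.sub y'.2).norm.ennreal_ofReal
  rw [hset, ← ENNReal.mul_le_mul_iff_right (ENNReal.ofReal_pos.2 hε).ne' ENNReal.ofReal_ne_top,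
    ← ENNReal.ofReal_mul hε.le]
  calc _ ≤ ∫⁻ ω, ENNReal.ofReal ‖y.1 ω - y'.1 ω‖ ∂P := mul_meas_ge_le_lintegral hmeas _
    _ ≤ momentDist P q y y' := lintegral_norm_sub_le_momentDist P hq y y'
    _ ≤ _ := h

universe u v w v' w'

lemma IsApproxSim.isProbApproxSim {Ω : Type u} [MeasurableSpace Ω] (P : Measure Ω)
    [IsProbabilityMeasure P] {n : ℕ} {q : ℝ} (hq : 1 ≤ q) {ε ε' : ℝ} (hε : 0 < ε)
    {A : System.{u, v, w} (RandVar Ω n)} {B : System.{u, v', w'} (RandVar Ω n)}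
    {R : A.State → B.State → Prop} (h : IsApproxSim (momentDist P q) (ε * ε') A B R) :
    IsProbApproxSim P ε ε' A B R :=
  ⟨h.1, fun a b hab => measure_le_of_momentDist_le P hq hε (h.2.1 a b hab), h.2.2⟩

lemma ApproxBisimilar.probApproxBisimilar {Ω : Type u} [MeasurableSpace Ω] (P : Measure Ω)
    [IsProbabilityMeasure P] {n : ℕ} {q : ℝ} (hq : 1 ≤ q) {ε ε' : ℝ} (hε : 0 < ε)
    {A : System.{u, v, w} (RandVar Ω n)} {B : System.{u, v', w'} (RandVar Ω n)}
    (h : ApproxBisimilar (momentDist P q) (ε * ε') A B) :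
    ProbApproxBisimilar P ε ε' A B := by
  obtain ⟨R, hAB, hBA⟩ := h
  exact ⟨R, hAB.isProbApproxSim P hq hε, hBA.isProbApproxSim P hq hε⟩

end StochSymb

theorem mainTheorem4 {Ω : Type*} [mΩ : MeasurableSpace Ω] (P : Measure Ω) [IsProbabilityMeasure P]
    (ℱ : Filtration ℝ≥0 mΩ) (hℱ : StochSymb.UsualConditions ℱ P)
    {n m p : ℕ} (W : ℝ≥0 → Ω → (Fin p → ℝ)) (hW : StochSymb.IsBrownianMotion ℱ P W)
    (τ : ℝ≥0) (hτ : 0 < τ) (η μ : ℝ) (hη : 0 < η) (hμ : 0 < μ)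
    (S : StochSymb.ControlSystem n m p) (hS : S.inputs = StochSymb.sampledInputs S.U τ)
    (q : ℝ) (hq : 1 ≤ q)
    (εprob : ℝ) (hεprob : 0 < εprob) (εhat : ℝ) (hεhat : εhat ∈ Set.Icc (0 : ℝ) 1)
    (h : StochSymb.ApproxBisimilar (StochSymb.momentDist P q) (εprob * εhat)
      (StochSymb.sampledSystem S ℱ P W τ) (StochSymb.symbolicSystem S Ω τ η μ)) :
    StochSymb.ProbApproxBisimilar P εprob εhat
      (StochSymb.sampledSystem S ℱ P W τ) (StochSymb.symbolicSystem S Ω τ η μ) := by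
  exact h.probApproxBisimilar P hq hεprob
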